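/- Let $R$ be a commutative ring and let $S\subset R$ be a multiplicative subset (containing $1$) that is at most countable. An $R$-module $C$ is called $S$-weakly cotorsion if $\operatorname{Ext}^1_R(S^{-1}R,C)=0$; an $R$-module $F$ is called $S$-strongly flat if $\operatorname{Ext}^1_R(F,C)=0$ for every $S$-weakly cotorsion $R$-module $C$. An $R$-module $G$ is a transfinitely iterated extension, in the sense of the projective limit, of modules $H_\alpha$, $\alpha<\delta$ ($\delta$ an ordinal), if there is an inverse system of $R$-modules $(G_\alpha)_{\alpha\le\delta}$ with $G_0=0$, $G_\delta=G$, with $G_\beta\to\varprojlim_{\alpha<\beta}G_\alpha$ an isomorphism for every limit ordinal $\beta\le\delta$, and with $G_{\alpha+1}\to G_\alpha$ surjective with kernel $H_\alpha$ for every $\alpha<\delta$. An $R$-module is simply right obtainable from a class $\mathsf E$ of $R$-modules if it belongs to the smallest class that contains $\mathsf E$ and is closed under direct summands, extensions, cokernels of injective morphisms, arbitrary products, and transfinitely iterated extensions in the sense of the projective limit. The classes of modules right $1$-obtainable and right $2$-obtainable from $\mathsf E$ form the smallest pair of classes such that: (i) all modules in $\mathsf E$ are right $1$-obtainable, and all right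 $1$-obtainable modules are right $2$-obtainable; (ii) for $n=1,2$, every module simply right obtainable from right $n$-obtainable modules is right $n$-obtainable; (iii) the kernel of any surjective morphism from a right $2$-obtainable module to a right $1$-obtainable module is right $2$-obtainable; (iv) the cokernel of any injective morphism from a right $2$-obtainable module to a right $1$-obtainable module is right $1$-obtainable. Then: (a) A flat $R$-module $F$ is $S$-strongly flat if and only if the $R/sR$-module $F/sF$ is projective for every $s\in S$ and the $S^{-1}R$-module $S^{-1}F=S^{-1}R\otimes_R F$ is projective. (b) An $R$-module is $S$-weakly cotorsion if and only if it is right $1$-obtainable from the class of all $R/sR$-modules, $s\in S$, and all $S^{-1}R$-modules (viewed as $R$-modules by restriction of scalars). -/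

import Mathlib

open CategoryTheory TensorProduct

universe u

section Obtainable

variable {R : Type u} [Ring R]

/-- An inverse system of `R`-modules `G_α`, `α ≤ δ`, with `G_0 = 0`, with surjective maps
`G_{α+1} → G_α` for `α < δ`, and with `G_β → lim_{α < β} G_α` an isomorphism for all limit
ordinals `β ≤ δ`. Only the indices `α ≤ δ` are constrained or used. -/
structure InverseTower (R : Type u) [Ring R] (δ : Ordinal.{u}) where
  obj : Ordinal.{u} → ModuleCat.{u} R
  map : ∀ {α β : Ordinal.{u}}, α ≤ β → β ≤ δ → (obj β →ₗ[R] obj α)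
  map_refl : ∀ {α : Ordinal.{u}} (hα : α ≤ δ), map le_rfl hα = LinearMap.id
  map_comp : ∀ {α β γ : Ordinal.{u}} (hαβ : α ≤ β) (hβγ : β ≤ γ) (hγ : γ ≤ δ),
    (map hαβ (hβγ.trans hγ)).comp (map hβγ hγ) = map (hαβ.trans hβγ) hγ
  zero : Subsingleton (obj 0)
  surjective : ∀ {α : Ordinal.{u}} (hα : α < δ),
    Function.Surjective (map (Order.le_succ α) (Order.succ_le_of_lt hα))
  limit : ∀ {β : Ordinal.{u}} (hβ : β ≤ δ), Order.IsSuccLimit β →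
    ∀ x : (α : Set.Iio β) → obj α,
      (∀ (α α' : Set.Iio β) (h : α.1 ≤ α'.1), map h (α'.2.le.trans hβ) (x α') = x α) →
      ∃! y : obj β, ∀ α : Set.Iio β, map α.2.le hβ y = x α

/-- `G` is a transfinitely iterated extension, in the sense of the projective limit,
of modules from the class `P`. -/
def IsProjTransfiniteExtension (P : ObjectProperty (ModuleCat.{u} R)) (G : ModuleCat.{u} R) :
    Prop :=
  ∃ (δ : Ordinal.{u}) (T : InverseTower R δ), Nonempty (T.obj δ ≃ₗ[R] G) ∧
    ∀ (α : Ordinal.{u}) (hα : α < δ),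
      P (ModuleCat.of R
        (LinearMap.ker (T.map (Order.le_succ α) (Order.succ_le_of_lt hα))))

/-- The closure properties in the definition of simple right obtainability. -/
structure IsSimplyRightClosed (P : ObjectProperty (ModuleCat.{u} R)) : Prop where
  directSummand : ∀ X Y : ModuleCat.{u} R, Nonempty (Retract X Y) → P Y → P X
  extension : ∀ K : ShortComplex (ModuleCat.{u} R), K.ShortExact → P K.X₁ → P K.X₃ → P K.X₂
  cokernel : ∀ K : ShortComplex (ModuleCat.{u} R), K.ShortExact → P K.X₁ → P K.X₂ → P K.X₃
  product : ∀ (ι : Type u) (X : ι → ModuleCat.{u} R), (∀ i, P (X i)) →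
    P (ModuleCat.of R ((i : ι) → X i))
  transfiniteExtension : ∀ G : ModuleCat.{u} R, IsProjTransfiniteExtension P G → P G

/-- Membership in the smallest class that contains `E` and is closed under direct summands,
extensions, cokernels of injective morphisms, products and transfinitely iterated extensions
in the sense of the projective limit. -/
def IsSimplyRightObtainable (E : ObjectProperty (ModuleCat.{u} R)) (C : ModuleCat.{u} R) :
    Prop :=
  ∀ P : ObjectProperty (ModuleCat.{u} R), E ≤ P → IsSimplyRightClosed P → P C

/-- The generation rules for the pair (right `1`-obtainable, right `2`-obtainable). -/
structure IsRightObtainablePair (E P₁ P₂ : ObjectProperty (ModuleCat.{u} R)) : Prop where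
  seed : E ≤ P₁
  le : P₁ ≤ P₂
  simply₁ : ∀ C : ModuleCat.{u} R, IsSimplyRightObtainable P₁ C → P₁ C
  simply₂ : ∀ C : ModuleCat.{u} R, IsSimplyRightObtainable P₂ C → P₂ C
  kernel : ∀ K : ShortComplex (ModuleCat.{u} R), K.ShortExact → P₂ K.X₂ → P₁ K.X₃ → P₂ K.X₁
  cokernel : ∀ K : ShortComplex (ModuleCat.{u} R), K.ShortExact → P₂ K.X₁ → P₁ K.X₂ → P₁ K.X₃

/-- `C` lies in the first member of the smallest pair of classes that satisfies the
generation rules with seed class `E`. -/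
def IsRightOneObtainable (E : ObjectProperty (ModuleCat.{u} R)) (C : ModuleCat.{u} R) : Prop :=
  ∀ P₁ P₂ : ObjectProperty (ModuleCat.{u} R), IsRightObtainablePair E P₁ P₂ → P₁ C

end Obtainable

section MultiplicativeSubset

variable {R : Type u} [CommRing R]

/-- The `R`-module `M` is obtained by restriction of scalars from some `A`-module. -/
def IsRestrictionOfScalars (A : Type u) [CommRing A] [Algebra R A] (M : ModuleCat.{u} R) :
    Prop :=
  ∃ _ : Module A M, IsScalarTower R A M

/-- The class of all `R/sR`-modules, `s ∈ S`, and all `S⁻¹R`-modules, viewed as `R`-modules. -/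
def seedClass (S : Submonoid R) : ObjectProperty (ModuleCat.{u} R) := fun M =>
  (∃ s ∈ S, IsRestrictionOfScalars (R ⧸ Ideal.span {s}) M) ∨
    IsRestrictionOfScalars (Localization S) M

/-- `C` is `S`-weakly cotorsion: `Ext¹_R(S⁻¹R, C) = 0`. -/
def IsWeaklyCotorsion (S : Submonoid R) (C : ModuleCat.{u} R) : Prop :=
  Subsingleton (Abelian.Ext (ModuleCat.of R (Localization S)) C 1)

/-- `F` is `S`-strongly flat: `Ext¹_R(F, C) = 0` for all `S`-weakly cotorsion `C`. -/
def IsStronglyFlat (S : Submonoid R) (F : ModuleCat.{u} R) : Prop :=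
  ∀ C : ModuleCat.{u} R, IsWeaklyCotorsion S C → Subsingleton (Abelian.Ext F C 1)

end MultiplicativeSubset

/-! Let 𝓖 be the class of flat `F` with `F/sF` projective over `R/sR` for all `s ∈ S` and `S⁻¹F`
projective over `S⁻¹R`. It contains `S⁻¹R` and is closed under syzygies. If `A` is `R/sR` or `S⁻¹R`,
a projective presentation of `F ∈ 𝓖` splits after tensoring with `A`, so `Ext¹(F, C) = 0` for every
`A`-module `C`. The modules with `Ext¹(𝓖, C) = 0` and those with `Ext²(𝓖, C) = 0` form a pair
satisfying the generation rules; the transfinite rule is the dual Eklof lemma. Hence right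
1-obtainable modules are orthogonal to 𝓖, in particular weakly cotorsion
(`IsRightOneObtainable.extOrthogonal`).

Conversely, enumerate `S` as a sequence `s_n` with every element repeated infinitely often, and put
`t_n = s_0 ⋯ s_{n-1}`. The telescope `0 → R^(ℕ) → R^(ℕ) → S⁻¹R → 0` turns weak cotorsion of `C` into
solvability of `c_n - s_n c_{n+1} = b_n` for every sequence `b`. This makes `C/⋂ t_n C` the limit of
the `C/t_n C`, whose successive kernels are killed by elements of `S`. For `D = ⋂ t_n C`, let `Q` be
the module of sequences with `t_n c_n = c_0`, and `T = ∏ C[t_n]` the product of the `t_n`-torsion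
submodules. There are exact sequences `0 → Hom(S⁻¹R, C) → Q → T → 0` and `0 → T → Q → D → 0`, so
`D`, and then `C`, is obtainable.

In (a), strong flatness makes `Hom_A(A ⊗ F, -)` exact, since `A`-modules are weakly cotorsion; the
other direction follows from (b) and orthogonality to 𝓖. -/

/-! ### Vanishing of Ext along short exact sequences. -/

section ExtVanishing

variable {R : Type u} [Ring R]

/-- The short complex of modules given by an exact pair of linear maps. -/
abbrev shortComplexOfExact {K P F : Type u} [AddCommGroup K] [AddCommGroup P] [AddCommGroup F]
    [Module R K] [Module R P] [Module R F] {i : K →ₗ[R] P} {p : P →ₗ[R] F}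
    (h : Function.Exact i p) : ShortComplex (ModuleCat.{u} R) :=
  ShortComplex.mk (ModuleCat.ofHom i) (ModuleCat.ofHom p)
    (by ext x; exact h.apply_apply_eq_zero x)

theorem shortExact_shortComplexOfExact {K P F : Type u} [AddCommGroup K] [AddCommGroup P]
    [AddCommGroup F] [Module R K] [Module R P] [Module R F] {i : K →ₗ[R] P} {p : P →ₗ[R] F}
    (h : Function.Exact i p) (hi : Function.Injective i) (hp : Function.Surjective p) :
    (shortComplexOfExact h).ShortExact where
  exact := by
    rw [ShortComplex.ShortExact.moduleCat_exact_iff_function_exact]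
    exact h
  mono_f := (ModuleCat.mono_iff_injective _).2 hi
  epi_g := (ModuleCat.epi_iff_surjective _).2 hp

theorem exists_projective_presentation (F : ModuleCat.{u} R) :
    ∃ K : ShortComplex (ModuleCat.{u} R), K.ShortExact ∧ Projective K.X₂ ∧ K.X₃ = F :=
  have hp := Finsupp.linearCombination_id_surjective R F
  ⟨shortComplexOfExact (LinearMap.exact_subtype_ker_map (Finsupp.linearCombination R (id : F → F))),
    shortExact_shortComplexOfExact _ (Submodule.injective_subtype _) hp,
    (IsProjective.iff_projective _).1 inferInstance, rfl⟩

theorem subsingleton_ext_middle {K : ShortComplex (ModuleCat.{u} R)} (hK : K.ShortExact)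
    {X : ModuleCat.{u} R} {n : ℕ}
    (h₁ : Subsingleton (Abelian.Ext X K.X₁ n)) (h₃ : Subsingleton (Abelian.Ext X K.X₃ n)) :
    Subsingleton (Abelian.Ext X K.X₂ n) := by
  refine subsingleton_of_forall_eq 0 fun x => ?_
  obtain ⟨y, rfl⟩ := Abelian.Ext.covariant_sequence_exact₂ X hK x (Subsingleton.elim _ _)
  rw [Subsingleton.elim y 0, Abelian.Ext.zero_comp]

theorem subsingleton_ext_right {K : ShortComplex (ModuleCat.{u} R)} (hK : K.ShortExact)
    {X : ModuleCat.{u} R} {n : ℕ}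
    (h₂ : Subsingleton (Abelian.Ext X K.X₂ n)) (h₁ : Subsingleton (Abelian.Ext X K.X₁ (n + 1))) :
    Subsingleton (Abelian.Ext X K.X₃ n) := by
  refine subsingleton_of_forall_eq 0 fun x => ?_
  obtain ⟨y, rfl⟩ := Abelian.Ext.covariant_sequence_exact₃ X hK x rfl (Subsingleton.elim _ _)
  rw [Subsingleton.elim y 0, Abelian.Ext.zero_comp]

theorem subsingleton_ext_left {K : ShortComplex (ModuleCat.{u} R)} (hK : K.ShortExact)
    {X : ModuleCat.{u} R} {n : ℕ}
    (h₃ : Subsingleton (Abelian.Ext X K.X₃ n)) (h₂ : Subsingleton (Abelian.Ext X K.X₂ (n + 1))) :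
    Subsingleton (Abelian.Ext X K.X₁ (n + 1)) := by
  refine subsingleton_of_forall_eq 0 fun x => ?_
  obtain ⟨y, rfl⟩ := Abelian.Ext.covariant_sequence_exact₁ X hK x (Subsingleton.elim _ _) rfl
  rw [Subsingleton.elim y 0, Abelian.Ext.zero_comp]

/-- Reduces `Ext¹` to extending maps along `K.f`, a form in which products and inverse limits in the
target can be treated directly. -/
theorem subsingleton_ext_one_iff {K : ShortComplex (ModuleCat.{u} R)} (hK : K.ShortExact)
    (hP : Projective K.X₂) (C : ModuleCat.{u} R) :
    Subsingleton (Abelian.Ext K.X₃ C 1) ↔ ∀ f : K.X₁ ⟶ C, ∃ g : K.X₂ ⟶ C, K.f ≫ g = f := by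
  constructor
  · intro h f
    obtain ⟨y, hy⟩ := Abelian.Ext.contravariant_sequence_exact₁ hK C (Abelian.Ext.mk₀ f)
      (n₁ := 1) rfl (Subsingleton.elim _ _)
    obtain ⟨g, rfl⟩ := Abelian.Ext.addEquiv₀.symm.surjective y
    refine ⟨g, ?_⟩
    have : Abelian.Ext.mk₀ (K.f ≫ g) = Abelian.Ext.mk₀ f := by
      rw [← hy]; simp
    exact Abelian.Ext.addEquiv₀.symm.injective this
  · intro h
    refine subsingleton_of_forall_eq 0 fun x => ?_
    obtain ⟨y, rfl⟩ := Abelian.Ext.contravariant_sequence_exact₃ hK C x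
      (Abelian.Ext.eq_zero_of_projective _) (n₀ := 0) rfl
    obtain ⟨f, rfl⟩ := Abelian.Ext.addEquiv₀.symm.surjective y
    obtain ⟨g, rfl⟩ := h f
    simp [← Abelian.Ext.mk₀_comp_mk₀]

theorem subsingleton_ext_two_iff {K : ShortComplex (ModuleCat.{u} R)} (hK : K.ShortExact)
    (hP : Projective K.X₂) (C : ModuleCat.{u} R) :
    Subsingleton (Abelian.Ext K.X₃ C 2) ↔ Subsingleton (Abelian.Ext K.X₁ C 1) := by
  constructor
  · intro h
    refine subsingleton_of_forall_eq 0 fun x => ?_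
    obtain ⟨y, rfl⟩ := Abelian.Ext.contravariant_sequence_exact₁ hK C x (n₁ := 2) rfl
      (Subsingleton.elim _ _)
    rw [Abelian.Ext.eq_zero_of_projective y, Abelian.Ext.comp_zero]
  · intro h
    refine subsingleton_of_forall_eq 0 fun x => ?_
    obtain ⟨y, rfl⟩ := Abelian.Ext.contravariant_sequence_exact₃ hK C x
      (Abelian.Ext.eq_zero_of_projective _) (n₀ := 1) rfl
    rw [Subsingleton.elim y 0, Abelian.Ext.comp_zero]

end ExtVanishing

/-! ### The dual Eklof lemma, and obtainability versus Ext-orthogonality. -/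

section TransfiniteExtension

variable {R : Type u} [Ring R]

namespace InverseTower

variable {δ : Ordinal.{u}} (T : InverseTower R δ)

theorem map_map {α β γ : Ordinal.{u}} (hαβ : α ≤ β) (hβγ : β ≤ γ) (hγ : γ ≤ δ) (x : T.obj γ) :
    T.map hαβ (hβγ.trans hγ) (T.map hβγ hγ x) = T.map (hαβ.trans hβγ) hγ x :=
  LinearMap.congr_fun (T.map_comp hαβ hβγ hγ) x

/-- A compatible family of linear maps into a limit stage lifts to a linear map. -/
theorem exists_lift {β : Ordinal.{u}} (hβ : β ≤ δ) (hlim : Order.IsSuccLimit β) {P : Type u}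
    [AddCommGroup P] [Module R P] (g : (α : Set.Iio β) → P →ₗ[R] T.obj α)
    (hg : ∀ (α α' : Set.Iio β) (h : α.1 ≤ α'.1), T.map h (α'.2.le.trans hβ) ∘ₗ g α' = g α) :
    ∃ g' : P →ₗ[R] T.obj β, ∀ α : Set.Iio β, T.map α.2.le hβ ∘ₗ g' = g α := by
  have key (p : P) := T.limit hβ hlim (fun α => g α p)
    fun α α' h => LinearMap.congr_fun (hg α α' h) p
  choose f hf hu using fun p => (key p)
  refine ⟨{ toFun := f, map_add' := fun p q => ?_, map_smul' := fun r p => ?_ },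
    fun α => LinearMap.ext fun p => hf p α⟩
  · exact (hu (p + q) _ fun α => by rw [map_add, hf, hf, map_add]).symm
  · exact (hu (r • p) _ fun α => by
      rw [RingHom.id_apply, map_smul, hf, map_smul]).symm

theorem hom_ext {β : Ordinal.{u}} (hβ : β ≤ δ) (hlim : Order.IsSuccLimit β) {P : Type u}
    [AddCommGroup P] [Module R P] {g g' : P →ₗ[R] T.obj β}
    (h : ∀ α : Set.Iio β, T.map α.2.le hβ ∘ₗ g = T.map α.2.le hβ ∘ₗ g') : g = g' := by
  ext p
  exact (T.limit hβ hlim (fun α => T.map α.2.le hβ (g p)) fun α α' hα =>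
    T.map_map hα α'.2.le hβ _).unique (fun _ => rfl)
    fun α => (LinearMap.congr_fun (h α) p).symm

variable {K P : Type u} [AddCommGroup K] [AddCommGroup P] [Module R K] [Module R P]
  (i : K →ₗ[R] P) (f : K →ₗ[R] T.obj δ)

/-- An extension along `i` of the projection of `f` to some stage of the tower. -/
structure PartialExtension where
  stage : Ordinal.{u}
  stage_le : stage ≤ δ
  hom : P →ₗ[R] T.obj stage
  hom_comp : hom ∘ₗ i = T.map stage_le le_rfl ∘ₗ f

variable {T i f}

namespace PartialExtension

/-- The order by extension to a later stage. -/
def Le (a b : PartialExtension T i f) : Prop :=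
  ∃ h : a.stage ≤ b.stage, T.map h b.stage_le ∘ₗ b.hom = a.hom

theorem Le.trans {a b c : PartialExtension T i f} (h : a.Le b) (h' : b.Le c) : a.Le c := by
  obtain ⟨h, e⟩ := h
  obtain ⟨h', e'⟩ := h'
  refine ⟨h.trans h', ?_⟩
  rw [← e, ← e', ← LinearMap.comp_assoc, T.map_comp]

theorem Le.of_stage_le {a b : PartialExtension T i f} (h : a.Le b ∨ b.Le a)
    (hs : a.stage ≤ b.stage) : a.Le b := by
  obtain h | ⟨h, e⟩ := h
  · exact h
  · obtain ⟨s, hs', g, hg⟩ := a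
    obtain ⟨s', hs'', g', hg'⟩ := b
    obtain rfl : s = s' := le_antisymm hs h
    refine ⟨le_rfl, ?_⟩
    dsimp only at e ⊢
    rw [T.map_refl, LinearMap.id_comp] at e ⊢
    exact e.symm

theorem Le.refl (a : PartialExtension T i f) : a.Le a :=
  ⟨le_rfl, by rw [T.map_refl, LinearMap.id_comp]⟩

/-- The chain bound for Zorn's lemma: if no stage in the chain is largest, the supremum of the
stages is a limit ordinal, and the maps glue there. -/
theorem exists_upperBound (c : Set (PartialExtension T i f)) (hc : IsChain Le c) :
    ∃ b : PartialExtension T i f, ∀ a ∈ c, a.Le b := by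
  have htot {a b : PartialExtension T i f} (ha : a ∈ c) (hb : b ∈ c) : a.Le b ∨ b.Le a := by
    by_cases h : a = b
    · exact h ▸ .inl (Le.refl a)
    · exact hc ha hb h
  have hbdd : BddAbove (stage '' c) := ⟨δ, by rintro _ ⟨a, -, rfl⟩; exact a.stage_le⟩
  by_cases hne : c.Nonempty
  swap
  · refine ⟨⟨0, zero_le, 0, ?_⟩, fun a ha => (hne ⟨a, ha⟩).elim⟩
    have := T.zero
    ext; exact Subsingleton.elim _ _
  by_cases hmax : ∃ b ∈ c, ∀ a ∈ c, a.stage ≤ b.stage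
  · obtain ⟨b, hb, h⟩ := hmax
    exact ⟨b, fun a ha => Le.of_stage_le (htot ha hb) (h a ha)⟩
  push Not at hmax
  set β := sSup (stage '' c)
  have hle {a : PartialExtension T i f} (ha : a ∈ c) : a.stage ≤ β := le_csSup hbdd ⟨a, ha, rfl⟩
  have hβ : β ≤ δ := csSup_le (hne.image _) (by rintro _ ⟨a, -, rfl⟩; exact a.stage_le)
  have hex (γ : Set.Iio β) : ∃ a ∈ c, γ.1 < a.stage := by
    obtain ⟨_, ⟨a, ha, rfl⟩, h⟩ := exists_lt_of_lt_csSup (hne.image stage) γ.2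
    exact ⟨a, ha, h⟩
  have hlt {a : PartialExtension T i f} (ha : a ∈ c) : a.stage < β := by
    obtain ⟨b, hb, h⟩ := hmax a ha
    exact h.trans_le (hle hb)
  have hlim : Order.IsSuccLimit β := by
    obtain ⟨a, ha⟩ := hne
    refine ⟨fun h => (hlt ha).not_ge (h (hlt ha).le), fun γ hγ => ?_⟩
    obtain ⟨b, hb, h⟩ := hex ⟨γ, hγ.1⟩
    exact hγ.2 h (hlt hb)
  choose a ha hγ using hex
  -- The projection to stage `γ` does not depend on the chosen member of the chain.
  have hcompat {b : PartialExtension T i f} (hb : b ∈ c) (γ : Set.Iio β)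
      (h : γ.1 ≤ b.stage) :
      T.map (hγ γ).le (a γ).stage_le ∘ₗ (a γ).hom = T.map h b.stage_le ∘ₗ b.hom := by
    obtain ⟨h', e⟩ | ⟨h', e⟩ := htot (ha γ) hb
    · rw [← e, ← LinearMap.comp_assoc, T.map_comp]
    · rw [← e, ← LinearMap.comp_assoc, T.map_comp]
  obtain ⟨g, hg⟩ := T.exists_lift hβ hlim
    (fun γ => T.map (hγ γ).le (a γ).stage_le ∘ₗ (a γ).hom) fun γ γ' h => by
      rw [hcompat (ha γ') γ (h.trans (hγ γ').le), ← LinearMap.comp_assoc, T.map_comp]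
  refine ⟨⟨β, hβ, g, T.hom_ext hβ hlim fun γ => ?_⟩, fun b hb => ⟨hle hb, ?_⟩⟩
  · rw [← LinearMap.comp_assoc, hg, LinearMap.comp_assoc, hom_comp, ← LinearMap.comp_assoc,
      T.map_comp, ← LinearMap.comp_assoc, T.map_comp]
  · dsimp only
    rw [hg ⟨b.stage, hlt hb⟩, hcompat hb ⟨b.stage, hlt hb⟩ le_rfl, T.map_refl, LinearMap.id_comp]

/-- Lift the map to the next stage by projectivity of `P`. The error on `K` lies in the kernel of
the transition map; extending it to `P` supplies the correction. -/
theorem exists_succ [Module.Projective R P] (a : PartialExtension T i f) (ha : a.stage < δ)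
    (h : ∀ f : K →ₗ[R] LinearMap.ker (T.map (Order.le_succ a.stage) (Order.succ_le_of_lt ha)),
      ∃ g, g ∘ₗ i = f) : ∃ b : PartialExtension T i f, a.Le b ∧ a.stage < b.stage := by
  set π := T.map (Order.le_succ a.stage) (Order.succ_le_of_lt ha)
  obtain ⟨l, hl⟩ := Module.projective_lifting_property π a.hom (T.surjective ha)
  set f' := T.map (Order.succ_le_of_lt ha) le_rfl ∘ₗ f
  obtain ⟨g, hg⟩ := h ((f' - l ∘ₗ i).codRestrict (LinearMap.ker π) fun k => by
    have h1 := LinearMap.congr_fun hl (i k)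
    have h2 := LinearMap.congr_fun a.hom_comp k
    simp only [LinearMap.comp_apply] at h1 h2
    simp only [LinearMap.mem_ker, LinearMap.sub_apply, LinearMap.comp_apply, map_sub, h1, h2, f',
      sub_eq_zero]
    exact T.map_map _ _ _ _)
  refine ⟨⟨Order.succ a.stage, Order.succ_le_of_lt ha, l + Submodule.subtype _ ∘ₗ g, ?_⟩,
    ⟨Order.le_succ _, ?_⟩, Order.lt_succ _⟩
  · rw [LinearMap.add_comp, LinearMap.comp_assoc, hg, LinearMap.subtype_comp_codRestrict]
    exact add_sub_cancel _ _
  · change π ∘ₗ (l + Submodule.subtype _ ∘ₗ g) = a.hom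
    rw [LinearMap.comp_add, hl, ← LinearMap.comp_assoc, LinearMap.comp_ker_subtype,
      LinearMap.zero_comp, add_zero]

end PartialExtension

/-- The dual Eklof lemma. -/
theorem exists_extension [Module.Projective R P]
    (h : ∀ (α : Ordinal.{u}) (hα : α < δ)
      (f : K →ₗ[R] LinearMap.ker (T.map (Order.le_succ α) (Order.succ_le_of_lt hα))),
      ∃ g, g ∘ₗ i = f) : ∃ g : P →ₗ[R] T.obj δ, g ∘ₗ i = f := by
  obtain ⟨m, hm⟩ := exists_maximal_of_chains_bounded
    (PartialExtension.exists_upperBound (T := T) (i := i) (f := f))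
    fun h h' => h.trans h'
  have hmδ : m.stage = δ := by
    by_contra hne
    have hlt := m.stage_le.lt_of_ne hne
    obtain ⟨b, hmb, hb⟩ := m.exists_succ hlt (h _ hlt)
    exact hb.not_ge (hm b hmb).1
  obtain ⟨s, hs, g, hg⟩ := m
  obtain rfl : s = δ := hmδ
  exact ⟨g, by rw [hg, T.map_refl, LinearMap.id_comp]⟩

end InverseTower

/-- The right orthogonal class of a class of modules with respect to `Ext¹`. -/
def extOrthogonal (𝓖 : ObjectProperty (ModuleCat.{u} R)) : ObjectProperty (ModuleCat.{u} R) :=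
  fun C => ∀ F, 𝓖 F → Subsingleton (Abelian.Ext F C 1)

/-- The first syzygies of the members of a class of modules. -/
def syzygies (𝓖 : ObjectProperty (ModuleCat.{u} R)) : ObjectProperty (ModuleCat.{u} R) :=
  fun X => ∃ K : ShortComplex (ModuleCat.{u} R), K.ShortExact ∧ Projective K.X₂ ∧ 𝓖 K.X₃ ∧
    K.X₁ = X

theorem extOrthogonal_syzygies_iff {𝓖 : ObjectProperty (ModuleCat.{u} R)} {C : ModuleCat.{u} R} :
    extOrthogonal (syzygies 𝓖) C ↔ ∀ F, 𝓖 F → Subsingleton (Abelian.Ext F C 2) := by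
  constructor
  · intro h F hF
    obtain ⟨K, hK, hP, rfl⟩ := exists_projective_presentation F
    exact (subsingleton_ext_two_iff hK hP C).2 (h _ ⟨K, hK, hP, hF, rfl⟩)
  · rintro h _ ⟨K, hK, hP, hF, rfl⟩
    exact (subsingleton_ext_two_iff hK hP C).1 (h _ hF)

/-- Closure under syzygies serves only the cokernel rule, where `Ext¹(F, X₃)` lies between `Ext¹(F,
X₂)` and `Ext²(F, X₁)`. -/
theorem isSimplyRightClosed_extOrthogonal {𝓖 : ObjectProperty (ModuleCat.{u} R)}
    (h𝓖 : syzygies 𝓖 ≤ 𝓖) : IsSimplyRightClosed (extOrthogonal 𝓖) where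
  directSummand := by
    rintro X Y ⟨r⟩ hY F hF
    have := hY F hF
    refine subsingleton_of_forall_eq 0 fun x => ?_
    have h : (x.comp (Abelian.Ext.mk₀ r.i) (add_zero 1)).comp (Abelian.Ext.mk₀ r.r)
        (add_zero 1) = x := by
      rw [Abelian.Ext.comp_assoc_of_third_deg_zero, Abelian.Ext.mk₀_comp_mk₀, r.retract,
        Abelian.Ext.comp_mk₀_id]
    rw [← h, Subsingleton.elim (x.comp _ _) 0, Abelian.Ext.zero_comp]
  extension K hK h₁ h₃ F hF := subsingleton_ext_middle hK (h₁ F hF) (h₃ F hF)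
  cokernel K hK h₁ h₂ F hF := subsingleton_ext_right hK (h₂ F hF)
    (extOrthogonal_syzygies_iff.1 (fun G hG => h₁ G (h𝓖 G hG)) F hF)
  product := by
    intro ι X hX F hF
    obtain ⟨K, hK, hP, rfl⟩ := exists_projective_presentation F
    refine (subsingleton_ext_one_iff hK hP _).2 fun f => ?_
    choose g hg using fun i => (subsingleton_ext_one_iff hK hP _).1 (hX i _ hF)
      (f ≫ ModuleCat.ofHom (LinearMap.proj i))
    refine ⟨ModuleCat.ofHom (LinearMap.pi fun i => (g i).hom), ?_⟩
    ext x i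
    exact ConcreteCategory.congr_hom (hg i) x
  transfiniteExtension := by
    rintro G ⟨δ, T, ⟨e⟩, hT⟩ F hF
    obtain ⟨K, hK, hP, rfl⟩ := exists_projective_presentation F
    refine (subsingleton_ext_one_iff hK hP _).2 fun f => ?_
    have : Module.Projective R K.X₂ := (IsProjective.iff_projective _).2 hP
    obtain ⟨g, hg⟩ := T.exists_extension (i := K.f.hom) (f := e.symm.toLinearMap ∘ₗ f.hom)
      fun α hα f => by
        obtain ⟨g, hg⟩ := (subsingleton_ext_one_iff hK hP _).1 (hT α hα _ hF) (ModuleCat.ofHom f)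
        exact ⟨g.hom, congrArg ModuleCat.Hom.hom hg⟩
    refine ⟨ModuleCat.ofHom (e.toLinearMap ∘ₗ g), ?_⟩
    ext x
    have := LinearMap.congr_fun hg x
    simp only [LinearMap.comp_apply, LinearEquiv.coe_coe] at this
    simp [this]

theorem IsRightOneObtainable.extOrthogonal {𝓖 E : ObjectProperty (ModuleCat.{u} R)}
    (h𝓖 : syzygies 𝓖 ≤ 𝓖) (hE : E ≤ extOrthogonal 𝓖) {C : ModuleCat.{u} R}
    (hC : IsRightOneObtainable E C) : extOrthogonal 𝓖 C := by
  have h𝓖' : syzygies (syzygies 𝓖) ≤ syzygies 𝓖 := by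
    rintro _ ⟨K, hK, hP, h, rfl⟩
    exact ⟨K, hK, hP, h𝓖 _ h, rfl⟩
  -- By dimension shifting the second class consists of the `C` with `Ext²(𝓖, C) = 0`; rules (iii)
  -- and (iv) are then read off the long exact sequence.
  refine hC _ (_root_.extOrthogonal (syzygies 𝓖)) ⟨hE, fun C h G hG => h G (h𝓖 G hG),
    fun C h => h _ le_rfl (isSimplyRightClosed_extOrthogonal h𝓖),
    fun C h => h _ le_rfl (isSimplyRightClosed_extOrthogonal h𝓖'), ?_, ?_⟩
  · intro K hK h₂ h₃
    rw [extOrthogonal_syzygies_iff] at h₂ ⊢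
    exact fun F hF => subsingleton_ext_left hK (h₃ F hF) (h₂ F hF)
  · intro K hK h₁ h₂ F hF
    rw [extOrthogonal_syzygies_iff] at h₁
    exact subsingleton_ext_right hK (h₂ F hF) (h₁ F hF)

end TransfiniteExtension

/-! ### Flat modules with projective reductions, and part (a). -/

section BaseChange

variable {R : Type u} [CommRing R]

section Presentation

variable {K P F : Type u} [AddCommGroup K] [AddCommGroup P] [AddCommGroup F] [Module R K]
  [Module R P] [Module R F] {i : K →ₗ[R] P} {p : P →ₗ[R] F}

/-- An exact sequence with flat quotient splits after a base change that makes the quotient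
projective. -/
theorem exists_retraction_baseChange (A : Type u) [CommRing A] [Algebra R A]
    (h : Function.Exact i p) (hi : Function.Injective i) (hp : Function.Surjective p)
    [Module.Flat R F] [Module.Projective A (A ⊗[R] F)] :
    ∃ l : A ⊗[R] P →ₗ[A] A ⊗[R] K, l ∘ₗ i.baseChange A = LinearMap.id := by
  have hexact : Function.Exact (i.baseChange A) (p.baseChange A) := lTensor_exact A h hp
  have hinj : Function.Injective (i.baseChange A) :=
    LinearMap.lTensor_injective_of_exact_of_flat p hp i hi h A
  have hsurj : Function.Surjective (p.baseChange A) := LinearMap.lTensor_surjective A hp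
  exact (((Function.Exact.split_tfae' hexact).out 0 1 rfl rfl).mp
    ⟨hinj, Module.projective_lifting_property _ _ hsurj⟩).2

theorem exists_extension_of_projective_baseChange (A : Type u) [CommRing A] [Algebra R A]
    (h : Function.Exact i p) (hi : Function.Injective i) (hp : Function.Surjective p)
    [Module.Flat R F] [Module.Projective A (A ⊗[R] F)] {C : Type u} [AddCommGroup C] [Module R C]
    [Module A C] [IsScalarTower R A C] (f : K →ₗ[R] C) : ∃ g : P →ₗ[R] C, g ∘ₗ i = f := by
  obtain ⟨l, hl⟩ := exists_retraction_baseChange A h hi hp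
  refine ⟨(LinearMap.liftBaseChange A f ∘ₗ l).restrictScalars R ∘ₗ TensorProduct.mk R A P 1, ?_⟩
  ext k
  have := LinearMap.congr_fun hl (1 ⊗ₜ k)
  simp only [LinearMap.comp_apply, LinearMap.baseChange_tmul, LinearMap.id_apply] at this
  simp [this]

/-- Flatness of `F` keeps `N ⊗ K → N ⊗ P` injective. For `N ⊆ N'`, the injection `N ⊗ K → N ⊗ P → N'
⊗ P` factors through `N' ⊗ K`. -/
theorem flat_left_of_exact (h : Function.Exact i p) (hi : Function.Injective i)
    (hp : Function.Surjective p) [Module.Flat R F] [Module.Flat R P] : Module.Flat R K := by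
  refine Module.Flat.iff_lTensor_preserves_injective_linearMap.2 fun N N' _ _ _ _ f hf => ?_
  have h₁ : Function.Injective (i.rTensor N) := by
    rw [← LinearMap.lTensor_inj_iff_rTensor_inj]
    exact LinearMap.lTensor_injective_of_exact_of_flat p hp i hi h N
  have h₂ := (Module.Flat.lTensor_preserves_injective_linearMap (M := P) f hf).comp h₁
  refine Function.Injective.of_comp (f := i.rTensor N') ?_
  rw [← LinearMap.coe_comp, LinearMap.rTensor_comp_lTensor, ← LinearMap.lTensor_comp_rTensor]
  exact h₂

end Presentation

/-- Flat modules `F` such that `F/sF` is projective over `R/sR` for all `s ∈ S` and `S⁻¹F` is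
projective over `S⁻¹R`. -/
def flatProjectiveReductions (S : Submonoid R) : ObjectProperty (ModuleCat.{u} R) := fun F =>
  Module.Flat R F ∧
    (∀ s ∈ S, Module.Projective (R ⧸ Ideal.span {s}) ((R ⧸ Ideal.span {s}) ⊗[R] F)) ∧
    Module.Projective (Localization S) (Localization S ⊗[R] F)

variable (S : Submonoid R)

/-- The base-changed presentation splits, so the reduction of the syzygy is a direct summand of a
projective module. -/
theorem syzygies_flatProjectiveReductions_le :
    syzygies (flatProjectiveReductions S) ≤ flatProjectiveReductions S := by
  rintro _ ⟨K, hK, hP, ⟨hflat, hs, hloc⟩, rfl⟩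
  have : Module.Projective R K.X₂ := (IsProjective.iff_projective _).2 hP
  have hexact := (ShortComplex.ShortExact.moduleCat_exact_iff_function_exact K).1 hK.exact
  have hi := hK.moduleCat_injective_f
  have hp := hK.moduleCat_surjective_g
  refine ⟨flat_left_of_exact hexact hi hp, fun s hsS => ?_, ?_⟩
  · have := hs s hsS
    obtain ⟨l, hl⟩ := exists_retraction_baseChange (R ⧸ Ideal.span {s}) hexact hi hp
    exact Module.Projective.of_split _ _ hl
  · obtain ⟨l, hl⟩ := exists_retraction_baseChange (Localization S) hexact hi hp
    exact Module.Projective.of_split _ _ hl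

theorem seedClass_le_extOrthogonal :
    seedClass S ≤ extOrthogonal (flatProjectiveReductions S) := by
  rintro C hC F ⟨hflat, hs, hloc⟩
  obtain ⟨K, hK, hP, rfl⟩ := exists_projective_presentation F
  have hexact := (ShortComplex.ShortExact.moduleCat_exact_iff_function_exact K).1 hK.exact
  have hi := hK.moduleCat_injective_f
  have hp := hK.moduleCat_surjective_g
  refine (subsingleton_ext_one_iff hK hP C).2 fun f => ?_
  obtain ⟨g, hg⟩ : ∃ g : K.X₂ →ₗ[R] C, g ∘ₗ K.f.hom = f.hom := by
    obtain ⟨s, hsS, hm, ht⟩ | ⟨hm, ht⟩ := hC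
    · have := hs s hsS
      exact exists_extension_of_projective_baseChange (R ⧸ Ideal.span {s}) hexact hi hp f.hom
    · exact exists_extension_of_projective_baseChange (Localization S) hexact hi hp f.hom
  exact ⟨ModuleCat.ofHom g, ModuleCat.hom_ext hg⟩

theorem localization_mem_flatProjectiveReductions :
    flatProjectiveReductions S (ModuleCat.of R (Localization S)) := by
  refine ⟨IsLocalization.flat (Localization S) S, fun s hs => ?_, ?_⟩
  -- Multiplication by `s` is zero on one factor and invertible on the other.
  · have : Subsingleton ((R ⧸ Ideal.span {s}) ⊗[R] Localization S) := by
      refine subsingleton_of_forall_eq 0 fun x => ?_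
      induction x with
      | zero => rfl
      | add x y hx hy => rw [hx, hy, add_zero]
      | tmul a b =>
        have hb : b = s • (IsLocalization.mk' (Localization S) 1 ⟨s, hs⟩ * b) := by
          rw [Algebra.smul_def, ← mul_assoc, IsLocalization.mk'_spec' (Localization S) 1 ⟨s, hs⟩,
            map_one, one_mul]
        have ha : s • a = 0 := by
          obtain ⟨r, rfl⟩ := Ideal.Quotient.mk_surjective a
          rw [← Ideal.Quotient.mk_eq_mk, ← Submodule.Quotient.mk_smul,
            Submodule.Quotient.mk_eq_zero]
          exact Ideal.mul_mem_right _ _ (Ideal.mem_span_singleton_self s)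
        rw [hb, ← TensorProduct.smul_tmul, ha, TensorProduct.zero_tmul]
    infer_instance
  · exact Module.Projective.of_equiv
      (IsLocalization.moduleTensorEquiv S (Localization S) (Localization S) (Localization S))

theorem isWeaklyCotorsion_of_isRightOneObtainable {C : ModuleCat.{u} R}
    (hC : IsRightOneObtainable (seedClass S) C) : IsWeaklyCotorsion S C :=
  hC.extOrthogonal (syzygies_flatProjectiveReductions_le S) (seedClass_le_extOrthogonal S) _
    (localization_mem_flatProjectiveReductions S)

theorem isWeaklyCotorsion_of_seedClass {C : ModuleCat.{u} R} (hC : seedClass S C) :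
    IsWeaklyCotorsion S C :=
  seedClass_le_extOrthogonal S C hC _ (localization_mem_flatProjectiveReductions S)

variable {S}

theorem IsStronglyFlat.projective_baseChange {F : ModuleCat.{u} R} (hF : IsStronglyFlat S F)
    (A : Type u) [CommRing A] [Algebra R A]
    (hA : ∀ C : ModuleCat.{u} R, IsRestrictionOfScalars A C → seedClass S C) :
    Module.Projective A (A ⊗[R] F) := by
  refine Module.Projective.of_lifting_property' fun {X Y} _ _ _ _ q g hq => ?_
  -- The lifting criterion supplies only additive monoids; negation comes from the ring `A`.
  let _ : AddCommGroup X := Module.addCommMonoidToAddCommGroup A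
  let _ : AddCommGroup Y := Module.addCommMonoidToAddCommGroup A
  let _ : Module R X := Module.compHom X (algebraMap R A)
  let _ : Module R Y := Module.compHom Y (algebraMap R A)
  have _ : IsScalarTower R A X := IsScalarTower.of_algebraMap_smul fun _ _ => rfl
  have _ : IsScalarTower R A Y := IsScalarTower.of_algebraMap_smul fun _ _ => rfl
  have hK := shortExact_shortComplexOfExact (i := q.ker.subtype.restrictScalars R)
    (p := q.restrictScalars R) (LinearMap.exact_subtype_ker_map q) (Submodule.injective_subtype _)
    hq
  -- The kernel of `q` is an `A`-module, hence weakly cotorsion, so the map from `F` lifts over `R`;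
  -- extension of scalars then gives the lift over `A`.
  have hE := hF _ (isWeaklyCotorsion_of_seedClass S (hA (ModuleCat.of R q.ker)
    ⟨inferInstance, inferInstance⟩))
  obtain ⟨y, hy⟩ := Abelian.Ext.covariant_sequence_exact₃ F hK
    (Abelian.Ext.mk₀ (ModuleCat.ofHom (g.restrictScalars R ∘ₗ TensorProduct.mk R A F 1)))
    (n₁ := 1) rfl (Subsingleton.elim _ _)
  obtain ⟨k, rfl⟩ := Abelian.Ext.addEquiv₀.symm.surjective y
  have hk : k ≫ ModuleCat.ofHom (q.restrictScalars R) =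
      ModuleCat.ofHom (g.restrictScalars R ∘ₗ TensorProduct.mk R A F 1) := by
    refine Abelian.Ext.addEquiv₀.symm.injective ?_
    change Abelian.Ext.mk₀ _ = Abelian.Ext.mk₀ _
    rw [← hy]; simp
  refine ⟨LinearMap.liftBaseChange A k.hom, ?_⟩
  ext x
  have := ConcreteCategory.congr_hom hk x
  simpa using this

/-- Countability of `S` enters only through `hS`, the harder half of (b). -/
theorem isStronglyFlat_iff_of_forall_isRightOneObtainable
    (hS : ∀ C : ModuleCat.{u} R, IsWeaklyCotorsion S C → IsRightOneObtainable (seedClass S) C)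
    (F : ModuleCat.{u} R) (hF : Module.Flat R F) :
    IsStronglyFlat S F ↔
      (∀ s ∈ S, Module.Projective (R ⧸ Ideal.span {s})
        (F ⧸ (Ideal.span {s} • ⊤ : Submodule R F))) ∧
      Module.Projective (Localization S) (Localization S ⊗[R] F) := by
  have hequiv (s : R) : Nonempty ((R ⧸ Ideal.span {s}) ⊗[R] F ≃ₗ[R ⧸ Ideal.span {s}]
      F ⧸ (Ideal.span {s} • ⊤ : Submodule R F)) :=
    ⟨(TensorProduct.quotTensorEquivQuotSMul F (Ideal.span {s})).extendScalarsOfSurjective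
      Ideal.Quotient.mk_surjective⟩
  constructor
  · refine fun h => ⟨fun s hs => ?_, h.projective_baseChange _ fun C hC => .inr hC⟩
    have := h.projective_baseChange (R ⧸ Ideal.span {s}) fun C hC => .inl ⟨s, hs, hC⟩
    exact Module.Projective.of_equiv (hequiv s).some
  · rintro ⟨hs, hloc⟩ C hC
    refine (hS C hC).extOrthogonal (syzygies_flatProjectiveReductions_le S)
      (seedClass_le_extOrthogonal S) F ⟨hF, fun s hsS => ?_, hloc⟩
    have := hs s hsS
    exact Module.Projective.of_equiv (hequiv s).some.symm

end BaseChange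

/-! ### The telescope presentation of `S⁻¹R`. -/

section Telescope

variable {R : Type u} [CommRing R] {S : Submonoid R}

/-- Infinite repetition lets any `u ∈ S` occur past a prescribed index, which is what exactness of
the telescope requires. -/
theorem exists_seq_frequently_eq (hS : (S : Set R).Countable) :
    ∃ s : ℕ → S, ∀ (u : S) (N : ℕ), ∃ n, N ≤ n ∧ s n = u := by
  have : Countable S := hS
  obtain ⟨e, he⟩ := exists_surjective_nat S
  refine ⟨fun n => e n.unpair.1, fun u N => ?_⟩
  obtain ⟨k, rfl⟩ := he u
  exact ⟨Nat.pair k N, Nat.right_le_pair k N, by simp⟩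

/-- The product of the first `n` members of a sequence in `S`. -/
def partialProd (s : ℕ → S) (n : ℕ) : S := ∏ i ∈ Finset.range n, s i

theorem partialProd_zero (s : ℕ → S) : partialProd s 0 = 1 := Finset.prod_range_zero s

theorem partialProd_succ (s : ℕ → S) (n : ℕ) : partialProd s (n + 1) = partialProd s n * s n :=
  Finset.prod_range_succ s n

theorem partialProd_dvd (s : ℕ → S) {m n : ℕ} (h : m ≤ n) : partialProd s m ∣ partialProd s n :=
  Finset.prod_dvd_prod_of_subset _ _ _ (Finset.range_subset_range.2 h)

variable (s : ℕ → S)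

/-- The first map in the telescope presentation of the localization. -/
noncomputable def telescopeHom : (ℕ →₀ R) →ₗ[R] (ℕ →₀ R) :=
  Finsupp.linearCombination R fun n => Finsupp.single n 1 - Finsupp.single (n + 1) (s n : R)

/-- The second map in the telescope presentation of the localization. -/
noncomputable def telescopeProj : (ℕ →₀ R) →ₗ[R] Localization S :=
  Finsupp.linearCombination R fun n => IsLocalization.mk' (Localization S) 1 (partialProd s n)

theorem telescopeHom_single (n : ℕ) (a : R) :
    telescopeHom s (Finsupp.single n a) =
      Finsupp.single n a - Finsupp.single (n + 1) (s n * a) := by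
  simp [telescopeHom, smul_sub, mul_comm]

theorem telescopeProj_single (n : ℕ) (a : R) :
    telescopeProj s (Finsupp.single n a) =
      IsLocalization.mk' (Localization S) a (partialProd s n) := by
  rw [telescopeProj, Finsupp.linearCombination_single, Algebra.smul_def,
    ← IsLocalization.mk'_eq_mul_mk'_one]

theorem telescopeHom_apply_zero (x : ℕ →₀ R) : telescopeHom s x 0 = x 0 := by
  induction x using Finsupp.induction_linear with
  | zero => simp
  | add x y hx hy => simp [hx, hy]
  | single n a => simp [telescopeHom_single]

theorem telescopeHom_apply_succ (x : ℕ →₀ R) (m : ℕ) :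
    telescopeHom s x (m + 1) = x (m + 1) - s m * x m := by
  induction x using Finsupp.induction_linear with
  | zero => simp
  | add x y hx hy => simp [hx, hy]; ring
  | single n a =>
    obtain rfl | h := eq_or_ne n m
    · simp [telescopeHom_single]
    · simp [telescopeHom_single, h]

theorem telescopeHom_injective : Function.Injective (telescopeHom s) := by
  rw [← LinearMap.ker_eq_bot, LinearMap.ker_eq_bot']
  intro x hx
  ext n
  induction n with
  | zero => rw [← telescopeHom_apply_zero s x, hx]
  | succ n ih =>
    have := telescopeHom_apply_succ s x n
    rw [hx, ih] at this
    simpa using this.symm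

theorem telescopeProj_comp_telescopeHom : telescopeProj s ∘ₗ telescopeHom s = 0 := by
  ext n
  simp only [LinearMap.comp_apply, Finsupp.lsingle_apply, telescopeHom_single, map_sub,
    telescopeProj_single, LinearMap.zero_apply, partialProd_succ]
  rw [mul_one, sub_eq_zero, IsLocalization.mk'_eq_iff_eq]
  simp

/-- Modulo the range, an entry `y` at index `N` equals `s_N y` at `N + 1`; iterating gives `c = s_N
⋯ s_{M-1}`. -/
theorem single_sub_single_mem_range {N M : ℕ} (h : N ≤ M) :
    ∃ c : R, ∀ y : R, Finsupp.single N y - Finsupp.single M (c * y) ∈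
      LinearMap.range (telescopeHom s) := by
  induction M, h using Nat.le_induction with
  | base => exact ⟨1, fun y => by simp⟩
  | succ M _ ih =>
    obtain ⟨c, hc⟩ := ih
    refine ⟨s M * c, fun y => ?_⟩
    have := add_mem (hc y) (LinearMap.mem_range_self (telescopeHom s) (Finsupp.single M (c * y)))
    rwa [telescopeHom_single, sub_add_sub_cancel, ← mul_assoc] at this

theorem exists_sub_single_mem_range (x : ℕ →₀ R) :
    ∃ N₀ : ℕ, ∀ N, N₀ ≤ N → ∃ y : R, x - Finsupp.single N y ∈
      LinearMap.range (telescopeHom s) := by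
  induction x using Finsupp.induction_linear with
  | zero => exact ⟨0, fun N _ => ⟨0, by simp⟩⟩
  | add x y hx hy =>
    obtain ⟨N₁, h₁⟩ := hx
    obtain ⟨N₂, h₂⟩ := hy
    refine ⟨max N₁ N₂, fun N hN => ?_⟩
    obtain ⟨a, ha⟩ := h₁ N ((le_max_left _ _).trans hN)
    obtain ⟨b, hb⟩ := h₂ N ((le_max_right _ _).trans hN)
    refine ⟨a + b, ?_⟩
    rw [Finsupp.single_add, add_sub_add_comm]
    exact add_mem ha hb
  | single n a =>
    refine ⟨n, fun N hN => ?_⟩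
    obtain ⟨c, hc⟩ := single_sub_single_mem_range s hN
    exact ⟨_, hc a⟩

variable {s}

theorem telescopeProj_surjective (hs : ∀ (u : S) (N : ℕ), ∃ n, N ≤ n ∧ s n = u) :
    Function.Surjective (telescopeProj s) := by
  intro z
  obtain ⟨x, y, rfl⟩ := IsLocalization.exists_mk'_eq S z
  obtain ⟨n, -, rfl⟩ := hs y 0
  -- With `y = s_n`, `x / s_n = t_n x / t_{n+1}`.
  refine ⟨Finsupp.single (n + 1) (partialProd s n * x), ?_⟩
  rw [telescopeProj_single, partialProd_succ, IsLocalization.mk'_eq_iff_eq]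
  congr 1
  push_cast
  ring

theorem telescope_exact (hs : ∀ (u : S) (N : ℕ), ∃ n, N ≤ n ∧ s n = u) :
    Function.Exact (telescopeHom s) (telescopeProj s) := by
  intro x
  have hcomp (z : ℕ →₀ R) : telescopeProj s (telescopeHom s z) = 0 :=
    LinearMap.congr_fun (telescopeProj_comp_telescopeHom s) z
  refine ⟨fun hx => ?_, by rintro ⟨z, rfl⟩; exact hcomp z⟩
  obtain ⟨N, hN⟩ := exists_sub_single_mem_range s x
  obtain ⟨y, z, hz⟩ := hN N le_rfl
  have hy : telescopeProj s (Finsupp.single N y) = 0 := by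
    rw [← sub_sub_cancel x (Finsupp.single N y), ← hz, map_sub, hx, hcomp, sub_zero]
  rw [telescopeProj_single, IsLocalization.mk'_eq_zero_iff (M := S)] at hy
  obtain ⟨u, hu⟩ := hy
  -- The annihilator `u` of `y` reappears as `s_M` with `M ≥ N`; pushing `y` from `M` to `M + 1`
  -- multiplies it by `u` and kills it.
  obtain ⟨M, hM, rfl⟩ := hs u N
  obtain ⟨c, hc⟩ := single_sub_single_mem_range s hM
  have h := add_mem (add_mem (LinearMap.mem_range_self _ z) (hc y))
    (LinearMap.mem_range_self (telescopeHom s) (Finsupp.single M (c * y)))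
  rw [telescopeHom_single, mul_left_comm, hu, mul_zero, Finsupp.single_zero, sub_zero, hz,
    sub_add_sub_cancel, sub_add_cancel] at h
  exact h

theorem IsWeaklyCotorsion.exists_sub_smul_eq {C : ModuleCat.{u} R} (hC : IsWeaklyCotorsion S C)
    (hs : ∀ (u : S) (N : ℕ), ∃ n, N ≤ n ∧ s n = u) (b : ℕ → C) :
    ∃ c : ℕ → C, ∀ n, c n - s n • c (n + 1) = b n := by
  have hK := shortExact_shortComplexOfExact (telescope_exact hs) (telescopeHom_injective s)
    (telescopeProj_surjective hs)
  have hP : Projective (ModuleCat.of R (ℕ →₀ R)) := (IsProjective.iff_projective _).1 inferInstance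
  obtain ⟨g, hg⟩ := (subsingleton_ext_one_iff hK hP C).1 hC
    (ModuleCat.ofHom (Finsupp.linearCombination R b))
  refine ⟨fun n => g.hom (Finsupp.single n 1), fun n => ?_⟩
  have hg' : g.hom ∘ₗ telescopeHom s = Finsupp.linearCombination R b :=
    congrArg ModuleCat.Hom.hom hg
  have h := LinearMap.congr_fun hg' (Finsupp.single n 1)
  rw [LinearMap.comp_apply, telescopeHom_single, map_sub, Finsupp.linearCombination_single,
    one_smul] at h
  rw [← h, Submonoid.smul_def, ← map_smul, Finsupp.smul_single, smul_eq_mul]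

/-- By the telescope, `S⁻¹R` is the colimit of copies of `R` under multiplication by the `s_n`. -/
theorem exists_hom_localization {C : Type u} [AddCommGroup C] [Module R C]
    (hs : ∀ (u : S) (N : ℕ), ∃ n, N ≤ n ∧ s n = u) (c : ℕ → C)
    (hc : ∀ n, c n = s n • c (n + 1)) :
    ∃ φ : Localization S →ₗ[R] C,
      ∀ n, φ (IsLocalization.mk' (Localization S) 1 (partialProd s n)) = c n := by
  have hle : LinearMap.ker (telescopeProj s) ≤ LinearMap.ker (Finsupp.linearCombination R c) := by
    rw [(telescope_exact hs).linearMap_ker_eq, LinearMap.range_le_ker_iff]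
    ext n
    simp only [LinearMap.comp_apply, Finsupp.lsingle_apply, telescopeHom_single, map_sub,
      Finsupp.linearCombination_single, LinearMap.zero_apply, mul_one, one_smul]
    rw [sub_eq_zero]
    exact hc n
  refine ⟨(LinearMap.ker (telescopeProj s)).liftQ _ hle ∘ₗ
    ((telescopeProj s).quotKerEquivOfSurjective (telescopeProj_surjective hs)).symm.toLinearMap,
    fun n => ?_⟩
  have h : ((telescopeProj s).quotKerEquivOfSurjective (telescopeProj_surjective hs)).symm
      (IsLocalization.mk' (Localization S) 1 (partialProd s n)) =
      Submodule.Quotient.mk (Finsupp.single n 1) := by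
    rw [LinearEquiv.symm_apply_eq, ← telescopeProj_single]
    rfl
  rw [LinearMap.comp_apply, LinearEquiv.coe_coe, h]
  exact (Submodule.liftQ_apply _ _ _).trans (by simp)

theorem hom_localization_ext {C : Type u} [AddCommGroup C] [Module R C]
    (hs : ∀ (u : S) (N : ℕ), ∃ n, N ≤ n ∧ s n = u) {φ ψ : Localization S →ₗ[R] C}
    (h : ∀ n, φ (IsLocalization.mk' (Localization S) 1 (partialProd s n)) =
      ψ (IsLocalization.mk' (Localization S) 1 (partialProd s n))) : φ = ψ := by
  rw [← LinearMap.cancel_right (telescopeProj_surjective hs)]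
  ext n
  simpa [telescopeProj_single] using h n

end Telescope

/-! ### Building a weakly cotorsion module from the seed class. -/

section Obtaining

theorem IsProjTransfiniteExtension.mono {R : Type u} [Ring R]
    {P Q : ObjectProperty (ModuleCat.{u} R)} (h : P ≤ Q) {G : ModuleCat.{u} R}
    (hG : IsProjTransfiniteExtension P G) : IsProjTransfiniteExtension Q G := by
  obtain ⟨δ, T, e, hT⟩ := hG
  exact ⟨δ, T, e, fun α hα => h _ (hT α hα)⟩

theorem IsRightObtainablePair.isSimplyRightClosed {R : Type u} [Ring R]
    {E P₁ P₂ : ObjectProperty (ModuleCat.{u} R)} (h : IsRightObtainablePair E P₁ P₂) :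
    IsSimplyRightClosed P₁ where
  directSummand X Y r hY := h.simply₁ _ fun _ hP hc => hc.directSummand X Y r (hP _ hY)
  extension K hK h₁ h₃ := h.simply₁ _ fun _ hP hc => hc.extension K hK (hP _ h₁) (hP _ h₃)
  cokernel K hK h₁ h₂ := h.simply₁ _ fun _ hP hc => hc.cokernel K hK (hP _ h₁) (hP _ h₂)
  product ι X hX := h.simply₁ _ fun _ hP hc => hc.product ι X fun i => hP _ (hX i)
  transfiniteExtension G hG :=
    h.simply₁ _ fun _ hP hc => hc.transfiniteExtension G (hG.mono hP)

variable {R : Type u} [CommRing R] {S : Submonoid R}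

theorem seedClass_of_smul_eq_zero {C : ModuleCat.{u} R} (s : S) (h : ∀ x : C, s • x = 0) :
    seedClass S C := by
  have ht : Module.IsTorsionBySet R C (Ideal.span {(s : R)} : Set R) :=
    (Module.isTorsionBySet_span_singleton_iff _).2 fun {x} => h x
  exact .inl ⟨s, s.2, ht.module, ht.isScalarTower⟩

theorem seedClass_hom_localization (C : Type u) [AddCommGroup C] [Module R C] :
    seedClass S (ModuleCat.of R (Localization S →ₗ[R] C)) := by
  let m : Module (Localization S) (Localization S →ₗ[R] C) :=
    { smul a φ := φ ∘ₗ LinearMap.mulLeft R a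
      one_smul φ := LinearMap.ext fun x => congrArg φ (one_mul x)
      mul_smul a b φ := LinearMap.ext fun x => congrArg φ
        (show a * b * x = b * (a * x) by ring)
      smul_zero a := rfl
      smul_add a φ ψ := rfl
      add_smul a b φ := LinearMap.ext fun x =>
        (congrArg φ (add_mul a b x)).trans (map_add φ _ _)
      zero_smul φ := LinearMap.ext fun x => (congrArg φ (zero_mul x)).trans (map_zero φ) }
  refine .inr ⟨m, IsScalarTower.of_algebraMap_smul fun r φ => LinearMap.ext fun x => ?_⟩
  change φ (algebraMap R (Localization S) r * x) = r • φ x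
  rw [← Algebra.smul_def, map_smul]

variable (s : ℕ → S) (C : Type u) [AddCommGroup C] [Module R C]

/-- The elements divisible by the `n`-th partial product for all `n ≤ α`. -/
def divisibleUpTo (α : Ordinal.{u}) : Submodule R C :=
  ⨅ (n : ℕ) (_ : (n : Ordinal.{u}) ≤ α), LinearMap.range (LinearMap.lsmul R C (partialProd s n))

variable {C}

theorem mem_divisibleUpTo {α : Ordinal.{u}} {x : C} :
    x ∈ divisibleUpTo s C α ↔ ∀ n : ℕ, (n : Ordinal.{u}) ≤ α → ∃ y, partialProd s n • y = x := by
  simp [divisibleUpTo, Submodule.mem_iInf, Submonoid.smul_def]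

variable (C)

theorem divisibleUpTo_mono {α β : Ordinal.{u}} (h : α ≤ β) :
    divisibleUpTo s C β ≤ divisibleUpTo s C α := fun _ hx =>
  (mem_divisibleUpTo s).2 fun n hn => (mem_divisibleUpTo s).1 hx n (hn.trans h)

variable {C}

/-- Earlier products divide later ones, so at a finite stage `n` the submodule is just `t_n C`. -/
theorem smul_mem_divisibleUpTo (n : ℕ) (x : C) :
    partialProd s n • x ∈ divisibleUpTo s C (n : Ordinal.{u}) := by
  refine (mem_divisibleUpTo s).2 fun m hm => ?_
  obtain ⟨d, hd⟩ := partialProd_dvd s (Nat.cast_le.1 hm)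
  exact ⟨d • x, by rw [hd, mul_smul]⟩

variable {s}

/-- Completeness: write `c_{n+1} - c_n = t_n b_n` and solve `d_n - s_n d_{n+1} = b_n`. Then `c_n +
t_n d_n` is independent of `n` and is the limit. -/
theorem exists_sub_mem_divisibleUpTo
    (hC : ∀ b : ℕ → C, ∃ c : ℕ → C, ∀ n, c n - s n • c (n + 1) = b n) (c : ℕ → C)
    (hc : ∀ n : ℕ, c (n + 1) - c n ∈ divisibleUpTo s C (n : Ordinal.{u})) :
    ∃ y : C, ∀ n : ℕ, y - c n ∈ divisibleUpTo s C (n : Ordinal.{u}) := by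
  choose b hb using fun n => (mem_divisibleUpTo s).1 (hc n) n le_rfl
  obtain ⟨d, hd⟩ := hC b
  have hconst (n : ℕ) : c n + partialProd s n • d n = c 0 + d 0 := by
    induction n with
    | zero => rw [partialProd_zero, one_smul]
    | succ n ih =>
      have h : c (n + 1) = c n + partialProd s n • (d n - s n • d (n + 1)) := by
        rw [hd, hb, add_sub_cancel]
      rw [← ih, h, partialProd_succ, mul_smul, smul_sub]
      abel
  refine ⟨c 0 + d 0, fun n => ?_⟩
  rw [← hconst n, add_sub_cancel_left]
  exact smul_mem_divisibleUpTo s n _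

theorem mem_divisibleUpTo_omega0 {x : C}
    (h : ∀ n : ℕ, x ∈ divisibleUpTo s C (n : Ordinal.{u})) :
    x ∈ divisibleUpTo s C Ordinal.omega0.{u} :=
  (mem_divisibleUpTo s).2 fun n _ => (mem_divisibleUpTo s).1 (h n) n le_rfl

theorem existsUnique_lift_quotient
    (hC : ∀ b : ℕ → C, ∃ c : ℕ → C, ∀ n, c n - s n • c (n + 1) = b n)
    (x : (α : Set.Iio Ordinal.omega0.{u}) → C ⧸ divisibleUpTo s C α)
    (hx : ∀ (α α' : Set.Iio Ordinal.omega0.{u}) (h : α.1 ≤ α'.1),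
      Submodule.factor (divisibleUpTo_mono s C h) (x α') = x α) :
    ∃! y : C ⧸ divisibleUpTo s C Ordinal.omega0.{u}, ∀ α : Set.Iio Ordinal.omega0.{u},
      Submodule.factor (divisibleUpTo_mono s C (le_of_lt α.2)) y = x α := by
  let ν (n : ℕ) : Set.Iio Ordinal.omega0.{u} := ⟨n, Ordinal.natCast_lt_omega0 n⟩
  choose c hc using fun n => Submodule.Quotient.mk_surjective _ (x (ν n))
  have hdiff (n : ℕ) : c (n + 1) - c n ∈ divisibleUpTo s C (n : Ordinal.{u}) := by
    have h := hx (ν n) (ν (n + 1)) (Nat.cast_le.2 n.le_succ)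
    rw [← hc n, ← hc (n + 1)] at h
    exact (Submodule.Quotient.eq _).1 h
  obtain ⟨y, hy⟩ := exists_sub_mem_divisibleUpTo hC c hdiff
  refine ⟨Submodule.Quotient.mk y, fun α => ?_, fun z hz => ?_⟩
  · obtain ⟨n, hn⟩ := Ordinal.lt_omega0.1 α.2
    obtain rfl : α = ν n := Subtype.ext hn
    rw [← hc n]
    exact (Submodule.Quotient.eq _).2 (hy n)
  · obtain ⟨z, rfl⟩ := Submodule.Quotient.mk_surjective _ z
    refine (Submodule.Quotient.eq _).2 (mem_divisibleUpTo_omega0 fun n => ?_)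
    have h := hz (ν n)
    rw [← hc n] at h
    have h' : z - c n ∈ divisibleUpTo s C (n : Ordinal.{u}) := (Submodule.Quotient.eq _).1 h
    have := sub_mem h' (hy n)
    rwa [sub_sub_sub_cancel_right] at this

theorem subsingleton_quotient_divisibleUpTo_zero : Subsingleton (C ⧸ divisibleUpTo s C 0) := by
  refine (Submodule.Quotient.subsingleton_iff).2 (eq_top_iff.2 fun x _ => ?_)
  have := smul_mem_divisibleUpTo s 0 x
  rwa [partialProd_zero, one_smul, Nat.cast_zero] at this

theorem factor_divisibleUpTo_refl {α : Ordinal.{u}} (h : divisibleUpTo s C α ≤ divisibleUpTo s C α) :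
    Submodule.factor h = LinearMap.id :=
  Submodule.mapQ_id _ _

/-- The tower of quotients of `C` by multiples of partial products. -/
def completionTower (hC : ∀ b : ℕ → C, ∃ c : ℕ → C, ∀ n, c n - s n • c (n + 1) = b n) :
    InverseTower R Ordinal.omega0.{u} where
  obj α := ModuleCat.of R (C ⧸ divisibleUpTo s C α)
  map h _ := Submodule.factor (divisibleUpTo_mono s C h)
  map_refl _ := factor_divisibleUpTo_refl _
  map_comp _ _ _ := Submodule.factor_comp _ _
  zero := subsingleton_quotient_divisibleUpTo_zero
  surjective _ := Submodule.factor_surjective _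
  limit hβ hlim x hx := by
    -- The only limit ordinal at most ω is ω itself.
    obtain rfl := le_antisymm hβ (Ordinal.omega0_le_of_isSuccLimit hlim)
    exact existsUnique_lift_quotient hC x hx

theorem isProjTransfiniteExtension_quotient
    (hC : ∀ b : ℕ → C, ∃ c : ℕ → C, ∀ n, c n - s n • c (n + 1) = b n) :
    IsProjTransfiniteExtension (seedClass S)
      (ModuleCat.of R (C ⧸ divisibleUpTo s C Ordinal.omega0.{u})) := by
  refine ⟨_, completionTower hC, ⟨LinearEquiv.refl R _⟩, fun α hα => ?_⟩
  obtain ⟨n, rfl⟩ := Ordinal.lt_omega0.1 hα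
  -- The kernel lies in `C/t_{n+1} C`, which `t_{n+1}` annihilates.
  refine seedClass_of_smul_eq_zero (partialProd s (n + 1)) fun x => Subtype.ext ?_
  obtain ⟨x, hx⟩ := x
  obtain ⟨y, rfl⟩ := Submodule.Quotient.mk_surjective _ x
  refine (Submodule.Quotient.mk_eq_zero _).2 ?_
  have := smul_mem_divisibleUpTo s (n + 1) y
  rwa [Nat.cast_succ] at this

variable (s C)

/-- Sequences exhibiting their first member as divisible by all partial products. -/
def divisionSequences : Submodule R (ℕ → C) where
  carrier := {c | ∀ n, partialProd s n • c n = c 0}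
  add_mem' := fun {c d} hc hd n => by rw [Pi.add_apply, smul_add, hc, hd, Pi.add_apply]
  zero_mem' := fun n => smul_zero _
  smul_mem' := fun r c hc n => by rw [Pi.smul_apply, smul_comm, hc, Pi.smul_apply]

/-- The product of the submodules of elements annihilated by the partial products. -/
abbrev TorsionProduct : Type u :=
  (n : ULift.{u} ℕ) → Submodule.torsionBy R C (partialProd s n.down : R)

variable {s C}

theorem TorsionProduct.smul_eq_zero (x : TorsionProduct s C) (n : ℕ) :
    partialProd s n • (x ⟨n⟩ : C) = 0 := (x ⟨n⟩).2

theorem IsSimplyRightClosed.torsionProduct {P : ObjectProperty (ModuleCat.{u} R)}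
    (hP : IsSimplyRightClosed P) (hE : seedClass S ≤ P) :
    P (ModuleCat.of R (TorsionProduct s C)) :=
  hP.product _ (fun n : ULift.{u} ℕ =>
    ModuleCat.of R (Submodule.torsionBy R C (partialProd s n.down : R))) fun n =>
    hE _ (seedClass_of_smul_eq_zero (partialProd s n.down) fun x => Subtype.ext x.2)

/-- The map `c ↦ (c_n - s_n c_{n+1})` takes values in torsion because `t_n c_n = c_0 = t_{n+1}
c_{n+1}`. Its kernel is `Hom(S⁻¹R, C)`. -/
theorem IsSimplyRightClosed.divisionSequences {P : ObjectProperty (ModuleCat.{u} R)}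
    (hP : IsSimplyRightClosed P) (hE : seedClass S ≤ P)
    (hs : ∀ (u : S) (N : ℕ), ∃ n, N ≤ n ∧ s n = u)
    (hC : ∀ b : ℕ → C, ∃ c : ℕ → C, ∀ n, c n - s n • c (n + 1) = b n) :
    P (ModuleCat.of R (divisionSequences s C)) := by
  have hτ (n : ℕ) : s n • IsLocalization.mk' (Localization S) 1 (partialProd s (n + 1)) =
      IsLocalization.mk' (Localization S) 1 (partialProd s n) := by
    rw [Submonoid.smul_def, IsLocalization.smul_mk', IsLocalization.mk'_eq_iff_eq,
      partialProd_succ]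
    simp
  have hdiv (φ : Localization S →ₗ[R] C) (n : ℕ) : partialProd s n •
      φ (IsLocalization.mk' (Localization S) 1 (partialProd s n)) =
      φ (IsLocalization.mk' (Localization S) 1 (partialProd s 0)) := by
    rw [Submonoid.smul_def, ← map_smul, IsLocalization.smul_mk'_one, IsLocalization.mk'_self',
      partialProd_zero, IsLocalization.mk'_one, (algebraMap R (Localization S)).map_one]
  let i : (Localization S →ₗ[R] C) →ₗ[R] _root_.divisionSequences s C :=
    { toFun φ := ⟨fun n => φ (IsLocalization.mk' (Localization S) 1 (partialProd s n)), hdiv φ⟩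
      map_add' _ _ := rfl
      map_smul' _ _ := rfl }
  let p : _root_.divisionSequences s C →ₗ[R] TorsionProduct s C :=
    { toFun c n := ⟨c.1 n.down - s n.down • c.1 (n.down + 1), by
        have h₁ := c.2 n.down
        have h₂ := c.2 (n.down + 1)
        rw [partialProd_succ, mul_smul] at h₂
        rw [Submodule.mem_torsionBy_iff, ← Submonoid.smul_def, smul_sub, h₁, h₂, sub_self]⟩
      map_add' c d := by
        ext n
        exact (congrArg (_ - ·) (smul_add _ _ _)).trans (add_sub_add_comm _ _ _ _)
      map_smul' r c := by
        ext n
        change r • c.1 n.down - s n.down • r • c.1 (n.down + 1) =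
          r • (c.1 n.down - s n.down • c.1 (n.down + 1))
        rw [smul_sub, smul_comm r] }
  have hp (c : _root_.divisionSequences s C) (n : ℕ) :
      (p c ⟨n⟩ : C) = c.1 n - s n • c.1 (n + 1) := rfl
  have hexact : Function.Exact i p := by
    intro c
    constructor
    · intro h
      obtain ⟨φ, hφ⟩ := exists_hom_localization hs c.1 fun n => by
        rw [← sub_eq_zero, ← hp, h]; rfl
      exact ⟨φ, Subtype.ext (funext hφ)⟩
    · rintro ⟨φ, rfl⟩
      ext n
      change φ _ - s n.down • φ _ = 0
      rw [Submonoid.smul_def, ← map_smul, ← Submonoid.smul_def, hτ, sub_self]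
  have hi : Function.Injective i := fun φ ψ h =>
    hom_localization_ext hs fun n => congrFun (congrArg Subtype.val h) n
  have hsurj : Function.Surjective p := by
    intro x
    obtain ⟨c, hc⟩ := hC fun n => x ⟨n⟩
    refine ⟨⟨c, fun n => ?_⟩, funext fun n => Subtype.ext (hc n.down)⟩
    -- A solution with `t_n`-torsion right-hand sides satisfies `t_n c_n = t_{n+1} c_{n+1}`, so it
    -- is a division sequence.
    induction n with
    | zero => rw [partialProd_zero, one_smul]
    | succ n ih =>
      have h := x.smul_eq_zero n
      rw [← hc, smul_sub, ih, sub_eq_zero] at h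
      rw [partialProd_succ, mul_smul, ← h]
  exact hP.extension _ (shortExact_shortComplexOfExact hexact hi hsurj)
    (hE _ (seedClass_hom_localization C)) (hP.torsionProduct hE)

/-- Evaluation `c ↦ c_0` maps the division sequences onto `⋂ t_n C`; the choices of quotients by
`t_n` differ by torsion, which identifies the kernel. -/
theorem IsSimplyRightClosed.divisibleUpTo_omega0 {P : ObjectProperty (ModuleCat.{u} R)}
    (hP : IsSimplyRightClosed P) (hE : seedClass S ≤ P)
    (hs : ∀ (u : S) (N : ℕ), ∃ n, N ≤ n ∧ s n = u)
    (hC : ∀ b : ℕ → C, ∃ c : ℕ → C, ∀ n, c n - s n • c (n + 1) = b n) :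
    P (ModuleCat.of R (divisibleUpTo s C Ordinal.omega0.{u})) := by
  -- Since `t_0 = 1`, the factor of index 0 is trivial.
  have hzero (x : TorsionProduct s C) : (x ⟨0⟩ : C) = 0 := by
    simpa [partialProd_zero] using x.smul_eq_zero 0
  let i : TorsionProduct s C →ₗ[R] _root_.divisionSequences s C :=
    { toFun x := ⟨fun n => x ⟨n⟩, fun n => (x.smul_eq_zero n).trans (hzero x).symm⟩
      map_add' _ _ := rfl
      map_smul' _ _ := rfl }
  let p : _root_.divisionSequences s C →ₗ[R] divisibleUpTo s C Ordinal.omega0.{u} :=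
    { toFun c := ⟨c.1 0, (mem_divisibleUpTo s).2 fun n _ => ⟨c.1 n, c.2 n⟩⟩
      map_add' _ _ := rfl
      map_smul' _ _ := rfl }
  have hexact : Function.Exact i p := by
    intro c
    constructor
    · intro h
      have h0 : c.1 0 = 0 := congrArg Subtype.val h
      exact ⟨fun n => ⟨c.1 n.down, (c.2 n.down).trans h0⟩, rfl⟩
    · rintro ⟨x, rfl⟩
      exact Subtype.ext (hzero x)
  have hi : Function.Injective i := fun x y h => funext fun n => Subtype.ext
    (congrFun (congrArg Subtype.val h) n.down)
  have hsurj : Function.Surjective p := by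
    rintro ⟨x, hx⟩
    choose c hc using fun n : ℕ =>
      (mem_divisibleUpTo s).1 hx n (Ordinal.natCast_lt_omega0 n).le
    have h0 : c 0 = x := by simpa [partialProd_zero] using hc 0
    exact ⟨⟨c, fun n => (hc n).trans h0.symm⟩, Subtype.ext h0⟩
  exact hP.cokernel _ (shortExact_shortComplexOfExact hexact hi hsurj)
    (hP.torsionProduct hE) (hP.divisionSequences hE hs hC)

theorem IsWeaklyCotorsion.isRightOneObtainable (hS : (S : Set R).Countable) {C : ModuleCat.{u} R}
    (hC : IsWeaklyCotorsion S C) : IsRightOneObtainable (seedClass S) C := by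
  intro P₁ P₂ h
  obtain ⟨s, hs⟩ := exists_seq_frequently_eq hS
  have hC' := hC.exists_sub_smul_eq hs
  have hP := h.isSimplyRightClosed
  exact hP.extension _
    (shortExact_shortComplexOfExact
      (LinearMap.exact_subtype_mkQ (divisibleUpTo s C Ordinal.omega0.{u}))
      (Submodule.injective_subtype _) (Submodule.mkQ_surjective _))
    (hP.divisibleUpTo_omega0 h.seed hs hC')
    (hP.transfiniteExtension _ ((isProjTransfiniteExtension_quotient hC').mono h.seed))

end Obtaining

theorem mainTheorem7 {R : Type u} [CommRing R] (S : Submonoid R) (hS : (S : Set R).Countable) :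
    (∀ F : ModuleCat.{u} R, Module.Flat R F →
      (IsStronglyFlat S F ↔
        (∀ s ∈ S, Module.Projective (R ⧸ Ideal.span {s})
          (F ⧸ (Ideal.span {s} • ⊤ : Submodule R F))) ∧
        Module.Projective (Localization S) (Localization S ⊗[R] F))) ∧
    (∀ C : ModuleCat.{u} R, IsWeaklyCotorsion S C ↔ IsRightOneObtainable (seedClass S) C) :=
  ⟨isStronglyFlat_iff_of_forall_isRightOneObtainable fun _ hC => hC.isRightOneObtainable hS,
    fun _ => ⟨fun hC => hC.isRightOneObtainable hS, isWeaklyCotorsion_of_isRightOneObtainable S⟩⟩
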